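/- Egan's conjecture; an $n$-dimensional Grace–Danielsson inequality. Let $n \ge 1$ be an integer, and let $U$ be a Euclidean $n$-simplex, i.e. a simplex with $n+1$ affinely independent vertices in $\mathbb{R}^n$. Let $R$ be the radius of its circumscribed sphere, $r$ the radius of its inscribed sphere, and $d$ the distance between the centers of these two spheres. Then $$(R - nr)\,\bigl(R + (n-2)r\bigr) \;\ge\; d^2 .$$ -/

import Mathlib

open scoped RealInnerProductSpace

/-! The inequality is `((n - 1) r)² + d² ≤ (R - r)²`, with the difference of squares factored. Put
the origin at the incenter. Let `w i` be its barycentric coordinates, `u i` the outward unit normals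
and `v i` the vertices. Then `w i * ⟪u i, v j⟫ = r * w i - r * δ i j`, so `u` and `v` are dual up to
a rank-one term. For a unit vector `e` and `x² + y² = 1`, Cauchy–Schwarz pairs each `v i - c` with a
boosted normal of norm `1 + y ⟪u i, e⟫`. The weighted sum collapses to `x (n - 1) r + y ⟪c, e⟫ ≤ R -
r` (`mul_add_mul_le_of_dual_frame`). Taking `e` along `c` and varying `(x, y)` over the unit circle
gives the claim. -/

/-- A bound on a Euclidean norm from bounds on all its projections. -/
lemma sq_add_sq_le_sq_of_forall_unit {a b t : ℝ}
    (h : ∀ x y : ℝ, x ^ 2 + y ^ 2 = 1 → x * a + y * b ≤ t) : a ^ 2 + b ^ 2 ≤ t ^ 2 := by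
  rcases (by positivity : 0 ≤ a ^ 2 + b ^ 2).eq_or_lt with h0 | h0
  · rw [← h0]
    positivity
  · have hN : 0 < √(a ^ 2 + b ^ 2) := Real.sqrt_pos.2 h0
    have hsq : √(a ^ 2 + b ^ 2) ^ 2 = a ^ 2 + b ^ 2 := Real.sq_sqrt h0.le
    have hle := h (a / √(a ^ 2 + b ^ 2)) (b / √(a ^ 2 + b ^ 2)) (by
      rw [div_pow, div_pow, ← add_div, hsq, div_self h0.ne'])
    have heq : a / √(a ^ 2 + b ^ 2) * a + b / √(a ^ 2 + b ^ 2) * b = √(a ^ 2 + b ^ 2) := by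
      field_simp
      rw [hsq]
    rw [heq] at hle
    rw [← hsq]
    exact pow_le_pow_left₀ hN.le hle 2

section InnerProductSpace

variable {E : Type*} [NormedAddCommGroup E] [InnerProductSpace ℝ E]

/-- The spatial part of a (rescaled) Lorentz boost of the null vector `(u, 1)` in direction `e`. -/
lemma norm_boost {u e : E} {x y : ℝ} (hu : ‖u‖ = 1) (he : ‖e‖ = 1) (hxy : x ^ 2 + y ^ 2 = 1) :
    ‖x • u + ((1 - x) * ⟪u, e⟫ + y) • e‖ = 1 + y * ⟪u, e⟫ := by
  have hue : |⟪u, e⟫| ≤ 1 := by simpa [hu, he] using abs_real_inner_le_norm u e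
  have hy : |y| ≤ 1 := (sq_le_one_iff_abs_le_one y).1 (by nlinarith [sq_nonneg x])
  have hprod : |y * ⟪u, e⟫| ≤ 1 := by
    rw [abs_mul]
    exact mul_le_one₀ hy (abs_nonneg _) hue
  have hnn : 0 ≤ 1 + y * ⟪u, e⟫ := by linarith [(abs_le.1 hprod).1]
  rw [← sq_eq_sq₀ (norm_nonneg _) hnn, norm_add_sq_real, norm_smul, norm_smul, hu, he,
    real_inner_smul_left, real_inner_smul_right, mul_one, mul_one, Real.norm_eq_abs,
    Real.norm_eq_abs, sq_abs, sq_abs]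
  linear_combination (1 - ⟪u, e⟫ ^ 2) * hxy

variable {ι : Type*} [Fintype ι]

lemma mul_add_mul_le_of_dual_frame {u v : ι → E} {w : ι → ℝ} {c e : E} {r R m x y : ℝ}
    (hw : ∀ i, 0 ≤ w i) (hw1 : ∑ i, w i = 1) (hu : ∀ i, ‖u i‖ = 1)
    (hwu : ∑ i, w i • u i = 0) (hwv : ∑ i, w i • v i = 0)
    (hframe : ∀ z, ∑ i, (w i * ⟪u i, z⟫) • v i = -r • z)
    (htrace : ∑ i, w i * ⟪u i, v i⟫ = -(m * r))
    (hR : ∀ i, ‖v i - c‖ = R) (he : ‖e‖ = 1) (hxy : x ^ 2 + y ^ 2 = 1) :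
    x * ((m - 1) * r) + y * ⟪c, e⟫ ≤ R - r := by
  -- Each term is the slack in Cauchy–Schwarz. As the boosted norm is affine in `u i`, the weighted
  -- sum is computable from the frame identities.
  have hnonneg : 0 ≤ ∑ i, w i * (R * (1 + y * ⟪u i, e⟫) +
      ⟪v i - c, x • u i + ((1 - x) * ⟪u i, e⟫ + y) • e⟫) := by
    refine Finset.sum_nonneg fun i _ => mul_nonneg (hw i) ?_
    have h := abs_real_inner_le_norm (v i - c) (x • u i + ((1 - x) * ⟪u i, e⟫ + y) • e)
    rw [norm_boost (hu i) he hxy, hR i] at h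
    linarith [(abs_le.1 h).1]
  have hinner_u (z : E) : ∑ i, w i * ⟪u i, z⟫ = 0 := by
    have h := congrArg (fun a => ⟪a, z⟫) hwu
    simpa [sum_inner, real_inner_smul_left] using h
  have hinner_v : ∑ i, w i * ⟪v i, e⟫ = 0 := by
    have h := congrArg (fun a => ⟪a, e⟫) hwv
    simpa [sum_inner, real_inner_smul_left] using h
  have hee : ∑ i, w i * ⟪u i, e⟫ * ⟪v i, e⟫ = -r := by
    have h := congrArg (fun a => ⟪a, e⟫) (hframe e)
    simpa [sum_inner, real_inner_smul_left, he] using h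
  have hsum : ∑ i, w i * (R * (1 + y * ⟪u i, e⟫) +
      ⟪v i - c, x • u i + ((1 - x) * ⟪u i, e⟫ + y) • e⟫) =
      R * (∑ i, w i) + R * y * (∑ i, w i * ⟪u i, e⟫) + x * (∑ i, w i * ⟪u i, v i⟫)
        - x * (∑ i, w i * ⟪u i, c⟫) + (1 - x) * (∑ i, w i * ⟪u i, e⟫ * ⟪v i, e⟫)
        - (1 - x) * ⟪c, e⟫ * (∑ i, w i * ⟪u i, e⟫) + y * (∑ i, w i * ⟪v i, e⟫)
        - y * ⟪c, e⟫ * (∑ i, w i) := by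
    simp only [Finset.mul_sum, ← Finset.sum_add_distrib, ← Finset.sum_sub_distrib]
    refine Finset.sum_congr rfl fun i _ => ?_
    rw [inner_add_right, real_inner_smul_right, real_inner_smul_right, inner_sub_left,
      inner_sub_left, real_inner_comm (u i) (v i), real_inner_comm (u i) c]
    ring
  rw [hsum, hw1, hinner_u, hinner_u, hinner_v, hee, htrace] at hnonneg
  linarith

/-- If a sphere of radius `R` passes through the vertices `v i` of a simplex whose facets with
unit normals `u i` are tangent to the sphere of radius `r` about the origin, then its center `c`
satisfies the Grace–Danielsson inequality. -/
lemma sq_add_norm_sq_le_of_dual_frame [Nontrivial E] {u v : ι → E} {w : ι → ℝ} {c : E}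
    {r R m : ℝ}
    (hw : ∀ i, 0 ≤ w i) (hw1 : ∑ i, w i = 1) (hu : ∀ i, ‖u i‖ = 1)
    (hwu : ∑ i, w i • u i = 0) (hwv : ∑ i, w i • v i = 0)
    (hframe : ∀ z, ∑ i, (w i * ⟪u i, z⟫) • v i = -r • z)
    (htrace : ∑ i, w i * ⟪u i, v i⟫ = -(m * r))
    (hR : ∀ i, ‖v i - c‖ = R) :
    ((m - 1) * r) ^ 2 + ‖c‖ ^ 2 ≤ (R - r) ^ 2 := by
  -- When `c = 0` any unit vector serves; nontriviality provides one.
  obtain ⟨e, he, hce⟩ : ∃ e : E, ‖e‖ = 1 ∧ ⟪c, e⟫ = ‖c‖ := by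
    by_cases hc : c = 0
    · obtain ⟨e, he⟩ := exists_norm_eq E (zero_le_one (α := ℝ))
      exact ⟨e, he, by simp [hc]⟩
    · refine ⟨‖c‖⁻¹ • c, norm_smul_inv_norm hc, ?_⟩
      rw [real_inner_smul_right, real_inner_self_eq_norm_sq]
      field_simp
  refine sq_add_sq_le_sq_of_forall_unit fun x y hxy => ?_
  rw [← hce]
  exact mul_add_mul_le_of_dual_frame hw hw1 hu hwu hwv hframe htrace hR he hxy

end InnerProductSpace

namespace Affine.Simplex

variable {V P : Type*} [NormedAddCommGroup V] [InnerProductSpace ℝ V] [MetricSpace P]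
  [NormedAddTorsor V P] {n : ℕ} [NeZero n] (s : Simplex ℝ P n)

/-- The outward unit normal of the face opposite a vertex. -/
noncomputable def outwardNormal (i : Fin (n + 1)) : V :=
  (s.height i)⁻¹ • (s.altitudeFoot i -ᵥ s.points i)

lemma norm_outwardNormal (i : Fin (n + 1)) : ‖s.outwardNormal i‖ = 1 := by
  have h := s.height_pos i
  rw [outwardNormal, norm_smul, ← dist_eq_norm_vsub, dist_comm, norm_inv, Real.norm_eq_abs,
    abs_of_pos h]
  exact inv_mul_cancel₀ h.ne'

lemma inner_outwardNormal_vsub {i j : Fin (n + 1)} (h : i ≠ j) :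
    ⟪s.outwardNormal i, s.points j -ᵥ s.points i⟫ = s.height i := by
  have hi := s.height_pos i
  rw [outwardNormal, real_inner_smul_left, real_inner_comm, ← neg_vsub_eq_vsub_rev (s.points i),
    ← neg_vsub_eq_vsub_rev (s.points i), inner_neg_neg,
    s.inner_vsub_vsub_altitudeFoot_eq_height_sq h]
  field_simp

lemma inradius_eq_inv_sum_inv_height : s.inradius = (∑ i, (s.height i)⁻¹)⁻¹ := by
  have h := s.sum_excenterWeightsUnnorm_empty_pos
  rw [inradius_eq_abs_inv_sum, abs_of_pos (inv_pos.2 h)]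
  simp

lemma excenterWeights_empty_mul_height (i : Fin (n + 1)) :
    s.excenterWeights ∅ i * s.height i = s.inradius := by
  have hi := s.height_pos i
  simp only [excenterWeights, Pi.smul_apply, smul_eq_mul, inradius_eq_inv_sum_inv_height,
    excenterWeightsUnnorm_empty_apply]
  field_simp

lemma sum_excenterWeights_empty : ∑ i, s.excenterWeights ∅ i = 1 :=
  s.excenterExists_empty.sum_excenterWeights_eq_one

lemma sum_excenterWeights_empty_smul_vsub_incenter :
    ∑ i, s.excenterWeights ∅ i • (s.points i -ᵥ s.incenter) = 0 := by
  have h := Finset.univ.affineCombination_eq_weightedVSubOfPoint_vadd_of_sum_eq_one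
    (s.excenterWeights ∅) s.points s.sum_excenterWeights_empty s.incenter
  rw [← incenter_eq_affineCombination, Finset.weightedVSubOfPoint_apply] at h
  simpa using congrArg (· -ᵥ s.incenter) h.symm

/-- All vertices other than `i` lie at the same level along the normal. The vanishing weighted mean
of the levels, with `w i * height i = r`, fixes that level as `r`. -/
lemma inner_outwardNormal_vsub_incenter (i j : Fin (n + 1)) :
    ⟪s.outwardNormal i, s.points j -ᵥ s.incenter⟫ =
      s.inradius - if i = j then s.height i else 0 := by
  have hdiff (k : Fin (n + 1)) : ⟪s.outwardNormal i, s.points k -ᵥ s.incenter⟫ =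
      ⟪s.outwardNormal i, s.points i -ᵥ s.incenter⟫ + s.height i -
        if i = k then s.height i else 0 := by
    rw [← vsub_add_vsub_cancel (s.points k) (s.points i) s.incenter, inner_add_right]
    split_ifs with h
    · simp [h]
    · rw [s.inner_outwardNormal_vsub h]
      ring
  rw [hdiff]
  generalize ⟪s.outwardNormal i, s.points i -ᵥ s.incenter⟫ = b at hdiff ⊢
  have hzero := congrArg (fun z => ⟪s.outwardNormal i, z⟫)
    s.sum_excenterWeights_empty_smul_vsub_incenter
  simp only [inner_sum, real_inner_smul_right, inner_zero_right] at hzero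
  simp_rw [hdiff, mul_sub, mul_ite, mul_zero] at hzero
  rw [Finset.sum_sub_distrib, ← Finset.sum_mul, s.sum_excenterWeights_empty,
    Finset.sum_ite_eq, if_pos (Finset.mem_univ i), s.excenterWeights_empty_mul_height] at hzero
  linarith

lemma excenterWeights_empty_mul_inner (i j : Fin (n + 1)) :
    s.excenterWeights ∅ i * ⟪s.outwardNormal i, s.points j -ᵥ s.incenter⟫ =
      s.inradius * s.excenterWeights ∅ i - if i = j then s.inradius else 0 := by
  rw [inner_outwardNormal_vsub_incenter, mul_sub, mul_ite, mul_zero,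
    s.excenterWeights_empty_mul_height, mul_comm]

lemma sum_excenterWeights_empty_mul_inner :
    ∑ i, s.excenterWeights ∅ i * ⟪s.outwardNormal i, s.points i -ᵥ s.incenter⟫ =
      -(n * s.inradius) := by
  simp only [excenterWeights_empty_mul_inner, if_true, Finset.sum_sub_distrib, ← Finset.mul_sum,
    s.sum_excenterWeights_empty, Finset.sum_const, Finset.card_univ, Fintype.card_fin, nsmul_eq_mul]
  push_cast
  ring

lemma span_range_vsub_incenter (hs : affineSpan ℝ (Set.range s.points) = ⊤) :
    Submodule.span ℝ (Set.range fun i => s.points i -ᵥ s.incenter) = ⊤ := by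
  have h : vectorSpan ℝ (Set.range s.points) = ⊤ := by
    rw [← direction_affineSpan, hs, AffineSubspace.direction_top]
  rw [eq_top_iff, ← h, vectorSpan_def, Submodule.span_le]
  rintro _ ⟨_, ⟨i, rfl⟩, _, ⟨j, rfl⟩, rfl⟩
  beta_reduce
  rw [← vsub_sub_vsub_cancel_right (s.points i) (s.points j) s.incenter]
  exact Submodule.sub_mem _ (Submodule.subset_span ⟨i, rfl⟩) (Submodule.subset_span ⟨j, rfl⟩)

/-- Minkowski's relation for facet normals: pairing the sum with the `j`-th vertex gives `r - r =
0`, and the vertices span. -/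
lemma sum_excenterWeights_empty_smul_outwardNormal
    (hs : affineSpan ℝ (Set.range s.points) = ⊤) :
    ∑ i, s.excenterWeights ∅ i • s.outwardNormal i = 0 := by
  refine inner_self_eq_zero (𝕜 := ℝ).1 ?_
  generalize hz : ∑ i, s.excenterWeights ∅ i • s.outwardNormal i = z
  nth_rw 1 [← hz]
  have hmem : z ∈ Submodule.span ℝ (Set.range fun i => s.points i -ᵥ s.incenter) := by
    rw [s.span_range_vsub_incenter hs]
    trivial
  clear hz
  induction hmem using Submodule.span_induction with
  | mem z hz =>
    obtain ⟨j, rfl⟩ := hz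
    simp [sum_inner, real_inner_smul_left, excenterWeights_empty_mul_inner, ← Finset.mul_sum,
      s.sum_excenterWeights_empty]
  | zero => simp
  | add a b _ _ ha hb => rw [inner_add_right, ha, hb, add_zero]
  | smul t a _ ha => rw [real_inner_smul_right, ha, mul_zero]

/-- By linearity it suffices to take `z` a vertex: the rank-one term dies because the weighted
vertices sum to zero, leaving the `δ` term. -/
lemma sum_inner_outwardNormal_smul_vsub_incenter
    (hs : affineSpan ℝ (Set.range s.points) = ⊤) (z : V) :
    ∑ i, (s.excenterWeights ∅ i * ⟪s.outwardNormal i, z⟫) • (s.points i -ᵥ s.incenter) =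
      -s.inradius • z := by
  have hz : z ∈ Submodule.span ℝ (Set.range fun i => s.points i -ᵥ s.incenter) := by
    rw [s.span_range_vsub_incenter hs]
    trivial
  induction hz using Submodule.span_induction with
  | mem z hz =>
    obtain ⟨j, rfl⟩ := hz
    simp only [excenterWeights_empty_mul_inner, sub_smul, mul_smul, ite_smul, zero_smul,
      Finset.sum_sub_distrib, ← Finset.smul_sum, s.sum_excenterWeights_empty_smul_vsub_incenter,
      smul_zero, Finset.sum_ite_eq', Finset.mem_univ, if_true, zero_sub, neg_smul]
  | zero => simp
  | add a b _ _ ha hb =>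
    simp only [inner_add_right, mul_add, add_smul, Finset.sum_add_distrib, ha, hb, smul_add]
  | smul t a _ ha =>
    rw [smul_comm, ← ha, Finset.smul_sum]
    refine Finset.sum_congr rfl fun i _ => ?_
    rw [real_inner_smul_right, smul_smul, mul_left_comm]

end Affine.Simplex

theorem mainTheorem3 (n : ℕ) [NeZero n]
    (s : Affine.Simplex ℝ (EuclideanSpace ℝ (Fin n)) n) :
    dist s.circumcenter s.incenter ^ 2 ≤
      (s.circumradius - (n : ℝ) * s.inradius) *
        (s.circumradius + ((n : ℝ) - 2) * s.inradius) := by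
  have hs : affineSpan ℝ (Set.range s.points) = ⊤ :=
    s.independent.affineSpan_eq_top_iff_card_eq_finrank_add_one.2 (by simp)
  have h := sq_add_norm_sq_le_of_dual_frame (c := s.circumcenter -ᵥ s.incenter)
    (R := s.circumradius) (fun i => (s.excenterWeights_empty_pos i).le)
    s.sum_excenterWeights_empty s.norm_outwardNormal
    (s.sum_excenterWeights_empty_smul_outwardNormal hs)
    s.sum_excenterWeights_empty_smul_vsub_incenter
    (s.sum_inner_outwardNormal_smul_vsub_incenter hs)
    s.sum_excenterWeights_empty_mul_inner
    (fun i => by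
      rw [vsub_sub_vsub_cancel_right, ← dist_eq_norm_vsub]
      exact s.dist_circumcenter_eq_circumradius i)
  rw [← dist_eq_norm_vsub] at h
  linarith
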